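/- Let $n\ge 0$ be an integer (the case $n\ge 1$ is the one of interest) and let $M$ be a smooth $n$-dimensional manifold diffeomorphic to the Euclidean sphere $S^n$. Let $f:M\to\mathbb R^{n+1}$ be a smooth immersion equipped with a smooth transversal vector field $\xi$ that is a centroaffine normalization: there are a point $c\in\mathbb R^{n+1}$ (the center) and a constant $a\neq 0$ such that $\xi_x=a\,(f(x)-c)$ and $\xi_x\notin f_*(T_xM)$ for all $x\in M$. The induced connection $\nabla$ and the second fundamental form $g$ are defined by the Gauss formula $$D_X f_*Y=f_*\nabla_XY+g(X,Y)\,\xi ,$$ where $D$ is the standard flat connection of $\mathbb R^{n+1}$. Assume that $g$ is non-degenerate at every point (so that $f$ is a centroaffine ovaloid). Then $\nabla$ is geodesically complete. Moreover, the dual connection $\overline\nabla$, that is, the connection on $M$ characterized by $$X\,g(Y,Z)=g(\nabla_XY,Z)+g(Y,\overline\nabla_XZ)$$ for all vector fields $X,Y,Z$, exists and is geodesically complete. Here a connection on $M$ is geodesically complete if for every $x\in M$ and $v\in T_xM$ there is a geodesic $\gamma:\mathbb R\to M$, defined on the whole real line, with $\gamma(0)=x$ and $\gamma'(0)=v$.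 -/

import Mathlib

open Bundle Manifold
open scoped ContDiff Manifold

noncomputable section

/-! ### Geodesics and completeness of a connection on the tangent bundle -/

section Geodesics

variable {E : Type*} [NormedAddCommGroup E] [NormedSpace ℝ E]
  {H : Type*} [TopologicalSpace H] {I : ModelWithCorners ℝ E H}
  {M : Type*} [TopologicalSpace M] [ChartedSpace H M] [IsManifold I 1 M]

/-- The velocity vector `γ'(t)` of a curve in a manifold. -/
def curveVelocity (I : ModelWithCorners ℝ E H) (γ : ℝ → M) (t : ℝ) : TangentSpace I (γ t) :=
  mfderiv 𝓘(ℝ, ℝ) I γ t (1 : ℝ)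

/-- The covariant derivative `(D V / dt)(t)` of a vector field `V` along a curve `γ`.
In the coordinates `e` of the tangent bundle given by the chart at `γ t`, it is
`v'(t) + Γ(γ'(t), v(t))`, where `v` is the coordinate expression of `V` and where
`Γ(X, w) = ∇_X W` for the vector field `W` near `γ t` whose coordinates are constantly `w`
(this is `FiberBundle.extend E (V t)`). -/
def covDerivAlong (cov : CovariantDerivative I E (TangentSpace I : M → Type _))
    (γ : ℝ → M) (V : ∀ t, TangentSpace I (γ t)) (t : ℝ) : TangentSpace I (γ t) :=
  let e := trivializationAt E (TangentSpace I : M → Type _) (γ t)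
  e.symm (γ t) (deriv (fun s => (e ⟨γ s, V s⟩).2) t)
    + cov (FiberBundle.extend E (V t)) (γ t) (curveVelocity I γ t)

/-- A curve defined on the whole real line is a geodesic (affinely parametrized) of `cov` if it
is smooth and `∇_{γ'} γ' = 0` along it. -/
def IsGeodesic (cov : CovariantDerivative I E (TangentSpace I : M → Type _)) (γ : ℝ → M) : Prop :=
  ContMDiff 𝓘(ℝ, ℝ) I ∞ γ ∧ ∀ t, covDerivAlong cov γ (curveVelocity I γ) t = 0

/-- Geodesic completeness: for every point and every initial velocity there is a geodesic with
these initial data whose affine parameter runs over the whole real line. -/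
def IsGeodesicallyComplete (cov : CovariantDerivative I E (TangentSpace I : M → Type _)) : Prop :=
  ∀ (x : M) (v : TangentSpace I x), ∃ γ : ℝ → M, IsGeodesic cov γ ∧
    (⟨γ 0, curveVelocity I γ 0⟩ : TangentBundle I M) = ⟨x, v⟩

/-- `cov'` is dual (conjugate) to `cov` with respect to the field `g` of bilinear forms:
`X g(Y, Z) = g(∇_X Y, Z) + g(Y, ∇'_X Z)` for all vector fields. -/
def IsDualConnection (g : ∀ x : M, TangentSpace I x →L[ℝ] TangentSpace I x →L[ℝ] ℝ)
    (cov cov' : CovariantDerivative I E (TangentSpace I : M → Type _)) : Prop :=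
  ∀ (x : M) (X : TangentSpace I x) (Y Z : ∀ y : M, TangentSpace I y),
    MDiffAt (T% Y) x → MDiffAt (T% Z) x →
      mvfderiv I (fun y => g y (Y y) (Z y)) x X = g x (cov Y x X) (Z x) + g x (Y x) (cov' Z x X)

end Geodesics

/-! ### Affine hypersurfaces -/

/-- An immersed hypersurface `f : M → ℝⁿ⁺¹` equipped with a transversal vector field `ξ`. -/
structure AffineHypersurface (n : ℕ) (M : Type*) [TopologicalSpace M]
    [ChartedSpace (EuclideanSpace ℝ (Fin n)) M] where
  /-- the immersion -/
  f : M → EuclideanSpace ℝ (Fin (n + 1))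
  /-- the transversal vector field -/
  ξ : M → EuclideanSpace ℝ (Fin (n + 1))
  smooth_f : ContMDiff (𝓡 n) 𝓘(ℝ, EuclideanSpace ℝ (Fin (n + 1))) ∞ f
  smooth_ξ : ContMDiff (𝓡 n) 𝓘(ℝ, EuclideanSpace ℝ (Fin (n + 1))) ∞ ξ
  immersion : ∀ x, Function.Injective (mvfderiv (𝓡 n) f x)
  transversal : ∀ x, ξ x ∉ Set.range (mvfderiv (𝓡 n) f x)

namespace AffineHypersurface

variable {n : ℕ} {M : Type*} [TopologicalSpace M] [ChartedSpace (EuclideanSpace ℝ (Fin n)) M]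
  (S : AffineHypersurface n M)

/-- The differential `f_* : T_x M → ℝⁿ⁺¹`. -/
def push (x : M) : TangentSpace (𝓡 n) x →L[ℝ] EuclideanSpace ℝ (Fin (n + 1)) :=
  mvfderiv (𝓡 n) S.f x

/-- The linear map `(v, a) ↦ f_* v + a ξ_x` from `T_x M × ℝ` to `ℝⁿ⁺¹`. -/
def splitMap (x : M) : (TangentSpace (𝓡 n) x × ℝ) →ₗ[ℝ] EuclideanSpace ℝ (Fin (n + 1)) :=
  LinearMap.coprod (S.push x).toLinearMap (LinearMap.toSpanSingleton ℝ _ (S.ξ x))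

lemma splitMap_apply (x : M) (v : TangentSpace (𝓡 n) x) (a : ℝ) :
    S.splitMap x (v, a) = S.push x v + a • S.ξ x := by
  simp [splitMap]

lemma splitMap_injective (x : M) : Function.Injective (S.splitMap x) := by
  rw [injective_iff_map_eq_zero]
  rintro ⟨v, a⟩ h
  rw [splitMap_apply] at h
  have ha : a = 0 := by
    by_contra ha
    refine S.transversal x ⟨-(a⁻¹ • v), ?_⟩
    change S.push x (-(a⁻¹ • v)) = _
    have h2 : S.push x v = -(a • S.ξ x) := eq_neg_of_add_eq_zero_left h
    rw [map_neg, map_smul, h2, smul_neg, neg_neg, smul_smul, inv_mul_cancel₀ ha, one_smul]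
  subst ha
  have hv : S.push x v = S.push x 0 := by simpa using h
  have : v = 0 := S.immersion x hv
  simp [this]

lemma splitMap_bijective (x : M) : Function.Bijective (S.splitMap x) := by
  have : FiniteDimensional ℝ (TangentSpace (𝓡 n) x) :=
    inferInstanceAs (FiniteDimensional ℝ (EuclideanSpace ℝ (Fin n)))
  have h : Module.finrank ℝ (TangentSpace (𝓡 n) x) = n :=
    finrank_euclideanSpace_fin (𝕜 := ℝ) (n := n)
  exact ⟨S.splitMap_injective x, (LinearMap.injective_iff_surjective_of_finrank_eq_finrank
    (by simp [Module.finrank_prod, h])).1 (S.splitMap_injective x)⟩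

/-- The decomposition `ℝⁿ⁺¹ = f_*(T_x M) ⊕ ℝ ξ_x`. -/
def split (x : M) : (TangentSpace (𝓡 n) x × ℝ) ≃ₗ[ℝ] EuclideanSpace ℝ (Fin (n + 1)) :=
  LinearEquiv.ofBijective (S.splitMap x) (S.splitMap_bijective x)

/-- The tangential component: `w = f_* (tangentPart w) + (transversalPart w) ξ_x`. -/
def tangentPart (x : M) : EuclideanSpace ℝ (Fin (n + 1)) →L[ℝ] TangentSpace (𝓡 n) x :=
  LinearMap.toContinuousLinearMap (LinearMap.fst ℝ _ _ ∘ₗ (S.split x).symm.toLinearMap)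

/-- The transversal component: `w = f_* (tangentPart w) + (transversalPart w) ξ_x`. -/
def transversalPart (x : M) : EuclideanSpace ℝ (Fin (n + 1)) →L[ℝ] ℝ :=
  LinearMap.toContinuousLinearMap (LinearMap.snd ℝ _ _ ∘ₗ (S.split x).symm.toLinearMap)

lemma split_eq (x : M) (w : EuclideanSpace ℝ (Fin (n + 1))) :
    S.push x (S.tangentPart x w) + S.transversalPart x w • S.ξ x = w := by
  have h : S.splitMap x ((S.split x).symm w) = w := by
    exact (S.split x).apply_symm_apply w
  conv_rhs => rw [← h]
  exact (S.splitMap_apply x _ _).symm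

lemma split_symm_push (x : M) (v : TangentSpace (𝓡 n) x) :
    (S.split x).symm (S.push x v) = (v, 0) := by
  rw [LinearEquiv.symm_apply_eq]
  exact (by simp [splitMap_apply] : S.push x v = S.splitMap x (v, 0))

@[simp] lemma tangentPart_push (x : M) (v : TangentSpace (𝓡 n) x) :
    S.tangentPart x (S.push x v) = v :=
  congrArg Prod.fst (S.split_symm_push x v)

@[simp] lemma transversalPart_push (x : M) (v : TangentSpace (𝓡 n) x) :
    S.transversalPart x (S.push x v) = 0 :=
  congrArg Prod.snd (S.split_symm_push x v)

/-- The vector field `f_* Y` along `f`. -/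
def pushField (Y : ∀ y : M, TangentSpace (𝓡 n) y) (y : M) : EuclideanSpace ℝ (Fin (n + 1)) :=
  S.push y (Y y)

lemma pushField_add (Y Z : ∀ y : M, TangentSpace (𝓡 n) y) :
    S.pushField (Y + Z) = S.pushField Y + S.pushField Z := by
  ext1 y; simp [pushField]

lemma pushField_smul (a : M → ℝ) (Y : ∀ y : M, TangentSpace (𝓡 n) y) :
    S.pushField (a • Y) = a • S.pushField Y := by
  ext1 y; simp [pushField]

variable [IsManifold (𝓡 n) ∞ M]

lemma mdiffAt_pushField {Y : ∀ y : M, TangentSpace (𝓡 n) y} {x : M}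
    (hY : MDifferentiableAt (𝓡 n) ((𝓡 n).prod 𝓘(ℝ, EuclideanSpace ℝ (Fin n)))
      (fun y => TotalSpace.mk' (EuclideanSpace ℝ (Fin n)) y (Y y)) x) :
    MDifferentiableAt (𝓡 n) 𝓘(ℝ, EuclideanSpace ℝ (Fin (n + 1))) (S.pushField Y) x := by
  have h1 : ContMDiff (𝓡 n).tangent 𝓘(ℝ, EuclideanSpace ℝ (Fin (n + 1))).tangent 1
      (tangentMap (𝓡 n) 𝓘(ℝ, EuclideanSpace ℝ (Fin (n + 1))) S.f) :=
    S.smooth_f.contMDiff_tangentMap (by norm_cast)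
  have h2 := contMDiff_snd_tangentBundle_modelSpace
    (EuclideanSpace ℝ (Fin (n + 1))) 𝓘(ℝ, EuclideanSpace ℝ (Fin (n + 1))) (n := 1)
  exact ((h2.comp h1).mdifferentiableAt (by simp)).comp x hY

/-- The induced connection: `∇_X Y` is the tangential component of `D_X (f_* Y)`. -/
def inducedConnection : CovariantDerivative (𝓡 n) (EuclideanSpace ℝ (Fin n))
    (TangentSpace (𝓡 n) : M → Type _) where
  toFun Y x := S.tangentPart x ∘L mvfderiv (𝓡 n) (S.pushField Y) x
  isCovariantDerivativeOnUniv :=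
    { add := by
        intro Y Z x hY hZ _
        rw [pushField_add, mvfderiv_add (S.mdiffAt_pushField hY) (S.mdiffAt_pushField hZ)]
        ext1 v
        simp
      leibniz := by
        intro Y a x hY ha _
        rw [pushField_smul, mvfderiv_smul ha (S.mdiffAt_pushField hY)]
        ext1 v
        simp [pushField] }

lemma tensorialAt_transversal (x : M) :
    TensorialAt (𝓡 n) (EuclideanSpace ℝ (Fin n))
      (fun Y : ∀ y : M, TangentSpace (𝓡 n) y =>
        S.transversalPart x ∘L mvfderiv (𝓡 n) (S.pushField Y) x) x where
  smul {a Y} ha hY := by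
    rw [pushField_smul, mvfderiv_smul ha (S.mdiffAt_pushField hY)]
    ext1 v
    simp [pushField]
  add {Y Z} hY hZ := by
    rw [pushField_add, mvfderiv_add (S.mdiffAt_pushField hY) (S.mdiffAt_pushField hZ)]
    ext1 v
    simp

/-- The second fundamental form: `g(X, Y)` is the transversal component of `D_X (f_* Y)`, which
depends only on the values of `X` and `Y` at the point. (The first argument of the map below is
the differentiated field `Y`; the form is symmetric.) -/
def secondFundamentalForm (x : M) :
    TangentSpace (𝓡 n) x →L[ℝ] TangentSpace (𝓡 n) x →L[ℝ] ℝ :=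
  haveI : IsManifold (𝓡 n) 1 M := .of_le (n := ∞) (by norm_cast)
  TensorialAt.mkHom _ x (S.tensorialAt_transversal x)

/-- The Gauss formula `D_X (f_* Y) = f_* (∇_X Y) + g(X, Y) ξ`. -/
theorem gauss_formula {x : M} (X : TangentSpace (𝓡 n) x) {Y : ∀ y : M, TangentSpace (𝓡 n) y}
    (hY : MDifferentiableAt (𝓡 n) ((𝓡 n).prod 𝓘(ℝ, EuclideanSpace ℝ (Fin n)))
      (fun y => TotalSpace.mk' (EuclideanSpace ℝ (Fin n)) y (Y y)) x) :
    mvfderiv (𝓡 n) (fun y => mvfderiv (𝓡 n) S.f y (Y y)) x X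
      = mvfderiv (𝓡 n) S.f x (S.inducedConnection Y x X)
        + S.secondFundamentalForm x (Y x) X • S.ξ x := by
  have : IsManifold (𝓡 n) 1 M := .of_le (n := ∞) (by norm_cast)
  have h : S.secondFundamentalForm x (Y x) X
      = S.transversalPart x (mvfderiv (𝓡 n) (S.pushField Y) x X) := by
    change TensorialAt.mkHom _ x (S.tensorialAt_transversal x) (Y x) X = _
    rw [TensorialAt.mkHom_apply (S.tensorialAt_transversal x) hY]
    rfl
  rw [h]
  exact (S.split_eq x (mvfderiv (𝓡 n) (S.pushField Y) x X)).symm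

/-- The hypersurface is centroaffine: `ξ` is a non-zero constant multiple of the position vector
with respect to some centre `c`. -/
def IsCentroaffine : Prop :=
  ∃ (c : EuclideanSpace ℝ (Fin (n + 1))) (a : ℝ), a ≠ 0 ∧ ∀ x, S.ξ x = a • (S.f x - c)

/-- The hypersurface is non-degenerate: its second fundamental form is non-degenerate. -/
def IsNondegenerate : Prop :=
  ∀ (x : M) (v : TangentSpace (𝓡 n) x),
    (∀ w : TangentSpace (𝓡 n) x, S.secondFundamentalForm x v w = 0) → v = 0

/-- A centroaffine ovaloid: a non-degenerate centroaffine hypersurface whose underlying manifold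
is diffeomorphic to the Euclidean sphere `Sⁿ`. -/
def IsCentroaffineOvaloid : Prop :=
  Nonempty (M ≃ₘ^∞⟮𝓡 n, 𝓡 n⟯ Metric.sphere (0 : EuclideanSpace ℝ (Fin (n + 1))) 1) ∧
    S.IsCentroaffine ∧ S.IsNondegenerate

end AffineHypersurface

end

/-!
Given `x` and `v`, put `p = f x - c`, `w = f_* v` and `J = p ∧ w`. The tangential component of
`‖f - c‖⁻² J (f - c)` is a smooth vector field on `M` with value `v` at `x`, and it is complete
because `M` is compact. Along an integral curve `γ`, the curve `σ = f ∘ γ - c` satisfies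
`σ' = ‖σ‖⁻² J σ + l σ` for some function `l`; hence it stays in the plane of `J` and has constant
areal velocity, so its acceleration is parallel to `σ`, that is, to `ξ`. This says that `γ` is a
geodesic of the induced connection.

The conormal field `ν`, with `⟨ν, f_* X⟩ = 0` and `⟨ν, ξ⟩ = 1`, is again a centroaffine
hypersurface when normalized by itself. Differentiating `⟨ν, f_* Y⟩ = 0` shows that its induced
connection is dual to that of `f`, so the dual connection is complete by the same argument.
-/

noncomputable section

local notation "𝔼" k:max => EuclideanSpace ℝ (Fin k)

section IntegralCurves

open Set Topology

lemma exists_nhds_forall_exists_hasDerivAt_mem {E : Type*} [NormedAddCommGroup E] [NormedSpace ℝ E]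
    [CompleteSpace E] {f : E → E} {x₀ : E} {u : Set E} (hf : ContDiffAt ℝ 1 f x₀) (hu : u ∈ 𝓝 x₀) :
    ∃ V ∈ 𝓝 x₀, ∃ ε > (0 : ℝ), ∀ x ∈ V, ∃ α : ℝ → E, α 0 = x ∧
      ∀ t ∈ Ioo (-ε) ε, α t ∈ u ∧ HasDerivAt α (f (α t)) t := by
  obtain ⟨δ, hδ, a, r, L, K, hr, hpl⟩ := IsPicardLindelof.of_contDiffAt_one hf
  obtain ⟨α, hα, hcont⟩ :=
    (hpl 0).exists_forall_mem_closedBall_eq_hasDerivWithinAt_continuousOn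
  have hball : Metric.closedBall x₀ (r : ℝ) ∈ 𝓝 x₀ := Metric.closedBall_mem_nhds _ hr
  have htime : Ioo (0 - δ) (0 + δ) ∈ 𝓝 (0 : ℝ) := Ioo_mem_nhds (by linarith) (by linarith)
  have hα₀ : α (x₀, 0) = x₀ := (hα x₀ (mem_of_mem_nhds hball)).1
  have hmem : ∀ᶠ p in 𝓝 x₀ ×ˢ 𝓝 (0 : ℝ), α p ∈ u := by
    rw [← nhds_prod_eq]
    exact (hcont.continuousAt (prod_mem_nhds hball (Filter.mem_of_superset htime
      Ioo_subset_Icc_self))).eventually_mem (by rwa [hα₀])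
  obtain ⟨V, hV, T, hT, hVT⟩ := Filter.eventually_prod_iff.1 hmem
  obtain ⟨ε, hε, hεT⟩ := Metric.mem_nhds_iff.1 (Filter.inter_mem hT htime)
  rw [Real.ball_eq_Ioo, zero_sub, zero_add] at hεT
  refine ⟨_, Filter.inter_mem hball hV, ε, hε, fun x hx ↦
    ⟨fun t ↦ α (x, t), (hα x hx.1).1, fun t ht ↦ ⟨hVT hx.2 (hεT ht).1, ?_⟩⟩⟩
  have htδ := (hεT ht).2
  exact ((hα x hx.1).2 t (Ioo_subset_Icc_self htδ)).hasDerivAt (Icc_mem_nhds htδ.1 htδ.2)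

variable {E : Type*} [NormedAddCommGroup E] [NormedSpace ℝ E]
  {H : Type*} [TopologicalSpace H] {I : ModelWithCorners ℝ E H}
  {M : Type*} [TopologicalSpace M] [ChartedSpace H M] [IsManifold I 1 M]
  {v : (x : M) → TangentSpace I x}

lemma hasMFDerivAt_extChartAt_symm_comp {x₀ : M} {u : ℝ → E} {t : ℝ}
    (hmem : u t ∈ interior (extChartAt I x₀).target)
    (hu : HasDerivAt u (tangentCoordChange I ((extChartAt I x₀).symm (u t)) x₀
      ((extChartAt I x₀).symm (u t)) (v ((extChartAt I x₀).symm (u t)))) t) :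
    HasMFDerivAt 𝓘(ℝ, ℝ) I ((extChartAt I x₀).symm ∘ u) t
      ((1 : ℝ →L[ℝ] ℝ).smulRight (v ((extChartAt I x₀).symm (u t)))) := by
  set y := (extChartAt I x₀).symm (u t)
  have htarget := interior_subset hmem
  have hsource : y ∈ (extChartAt I x₀).source := (extChartAt I x₀).map_target htarget
  have hself := mem_extChartAt_source (I := I) y
  have hv : tangentCoordChange I x₀ y y (tangentCoordChange I y x₀ y (v y)) = v y :=
    (tangentCoordChange_comp ⟨⟨hself, hsource⟩, hself⟩).trans (tangentCoordChange_self hself)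
  have hchange : HasFDerivAt (extChartAt I y ∘ (extChartAt I x₀).symm)
      (tangentCoordChange I x₀ y y) (u t) := by
    have h := hasFDerivWithinAt_tangentCoordChange (I := I) ⟨hsource, hself⟩
    rw [(extChartAt I x₀).right_inv htarget] at h
    exact h.hasFDerivAt (Filter.mem_of_superset (isOpen_interior.mem_nhds hmem)
      (interior_subset.trans (extChartAt_target_subset_range x₀)))
  have hd := hchange.comp_hasDerivAt t hu
  rw [hv] at hd
  exact ⟨(continuousAt_extChartAt_symm'' htarget).comp hu.continuousAt,
    hd.hasFDerivAt.hasFDerivWithinAt⟩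

theorem exists_nhds_forall_exists_isMIntegralCurveOn [CompleteSpace E] [BoundarylessManifold I M]
    {x₀ : M} (hv : CMDiffAt 1 (T% v) x₀) :
    ∃ U ∈ 𝓝 x₀, ∃ ε > (0 : ℝ), ∀ x ∈ U, ∃ γ : ℝ → M,
      γ 0 = x ∧ IsMIntegralCurveOn γ v (Ioo (-ε) ε) := by
  have hx₀ : I.IsInteriorPoint x₀ := BoundarylessManifold.isInteriorPoint
  have hcoord := ((contMDiffAt_iff.1 hv).2.contDiffAt (range_mem_nhds_isInteriorPoint hx₀)).snd
  obtain ⟨V, hV, ε, hε, hflow⟩ := exists_nhds_forall_exists_hasDerivAt_mem hcoord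
    (isOpen_interior.mem_nhds (I.isInteriorPoint_iff.1 hx₀))
  refine ⟨(extChartAt I x₀).source ∩ extChartAt I x₀ ⁻¹' V, Filter.inter_mem
    (extChartAt_source_mem_nhds x₀) ((continuousAt_extChartAt x₀).preimage_mem_nhds hV),
    ε, hε, fun x hx ↦ ?_⟩
  obtain ⟨α, hα₀, hα⟩ := hflow _ hx.2
  refine ⟨(extChartAt I x₀).symm ∘ α, ?_, fun t ht ↦ ?_⟩
  · rw [Function.comp_apply, hα₀, (extChartAt I x₀).left_inv hx.1]
  · obtain ⟨hmem, hd⟩ := hα t ht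
    exact (hasMFDerivAt_extChartAt_symm_comp hmem hd).hasMFDerivWithinAt

theorem exists_isMIntegralCurve_of_compactSpace [CompleteSpace E] [BoundarylessManifold I M]
    [T2Space M] [CompactSpace M] (hv : CMDiff 1 (T% v)) (x : M) :
    ∃ γ : ℝ → M, γ 0 = x ∧ IsMIntegralCurve γ v := by
  choose U hU ε hε hflow using fun x ↦ exists_nhds_forall_exists_isMIntegralCurveOn (hv x)
  obtain ⟨s, hs⟩ := finite_cover_nhds hU
  have hcover (z : M) : ∃ y ∈ s, z ∈ U y := by
    simpa only [mem_iUnion, exists_prop] using eq_univ_iff_forall.1 hs z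
  have hne : s.Nonempty := (hcover x).imp fun _ h ↦ h.1
  refine exists_isMIntegralCurve_of_isMIntegralCurveOn hv
    (ε := s.inf' hne ε) ((Finset.lt_inf'_iff hne).2 fun y _ ↦ hε y) (fun z ↦ ?_) x
  obtain ⟨y, hy, hzy⟩ := hcover z
  obtain ⟨γ, h0, h⟩ := hflow y z hzy
  have hle := Finset.inf'_le ε hy
  exact ⟨γ, h0, h.mono (Ioo_subset_Ioo (neg_le_neg hle) hle)⟩

theorem contMDiff_of_isMIntegralCurve {γ : ℝ → M} (hγ : IsMIntegralCurve γ v)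
    (hv : CMDiff ∞ (T% v)) : CMDiff ∞ γ := by
  refine contMDiff_infty.2 fun k ↦ ?_
  induction k with
  | zero => exact contMDiff_zero_iff.2 hγ.continuous
  | succ k ih =>
    intro t₀
    have hvγ : CMDiffAt k (fun t ↦ (⟨γ t, v (γ t)⟩ : TangentBundle I M)) t₀ :=
      ((hv.of_le (by exact_mod_cast le_top)).comp ih) t₀
    have hcoord := ((contMDiffAt_totalSpace (n := (k : WithTop ℕ∞))).1 hvγ).2.contDiffAt
    obtain ⟨s, hs, hd⟩ := (hγ.isMIntegralCurveAt t₀).eventually_hasDerivAt.exists_mem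
    refine contMDiffAt_iff_target.2 ⟨hγ.continuous.continuousAt, ?_⟩
    rw [contMDiffAt_iff_contDiffAt, Nat.cast_succ, contDiffAt_succ_iff_hasFDerivAt]
    exact ⟨_, ⟨s, hs, fun t ht ↦ (hd t ht).hasFDerivAt⟩,
      (ContinuousLinearMap.toSpanSingletonCLE (𝕜 := ℝ) (E := E)).contDiff.contDiffAt.comp t₀
        hcoord⟩

end IntegralCurves

section Calculus

variable {E : Type*} [NormedAddCommGroup E] [NormedSpace ℝ E]
  {H : Type*} [TopologicalSpace H] {I : ModelWithCorners ℝ E H}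
  {M : Type*} [TopologicalSpace M] [ChartedSpace H M]
  {F G : Type*} [NormedAddCommGroup F] [NormedSpace ℝ F] [NormedAddCommGroup G] [NormedSpace ℝ G]

lemma hasDerivAt_comp_curve {g : M → F} {γ : ℝ → M} {t : ℝ}
    (hg : MDiffAt g (γ t)) (hγ : MDiffAt γ t) :
    HasDerivAt (fun s ↦ g (γ s)) (mvfderiv I g (γ t) (curveVelocity I γ t)) t := by
  have h : HasFDerivAt (fun s ↦ g (γ s)) (mvfderiv I g (γ t) ∘L mfderiv% γ t : ℝ →L[ℝ] F) t :=
    (hg.hasMFDerivAt.comp t hγ.hasMFDerivAt).hasFDerivAt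
  exact h.hasDerivAt

lemma mvfderiv_comp_of_hasFDerivAt {Φ : F → G} {Φ' : F →L[ℝ] G} {g : M → F} {x : M}
    (hΦ : HasFDerivAt Φ Φ' (g x)) (hg : MDiffAt g x) :
    mvfderiv I (fun y ↦ Φ (g y)) x = Φ' ∘L mvfderiv I g x :=
  (hΦ.hasMFDerivAt.comp x hg.hasMFDerivAt).mfderiv

lemma mvfderiv_inner {F : Type*} [NormedAddCommGroup F] [InnerProductSpace ℝ F] {a b : M → F}
    {x : M} (ha : MDiffAt a x) (hb : MDiffAt b x) (X : TangentSpace I x) :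
    mvfderiv I (fun y ↦ inner ℝ (a y) (b y)) x X =
      inner ℝ (mvfderiv I a x X) (b x) + inner ℝ (a x) (mvfderiv I b x X) := by
  have hab : mvfderiv I (fun y ↦ (a y, b y)) x = (mvfderiv I a x).prod (mvfderiv I b x) := by
    rw [mvfderiv, modelWithCornersSelf_prod, ← chartedSpaceSelf_prod]
    exact (ha.hasMFDerivAt.prodMk hb.hasMFDerivAt).mfderiv
  have h := mvfderiv_comp_of_hasFDerivAt (g := fun y ↦ (a y, b y))
    (isBoundedBilinearMap_inner (𝕜 := ℝ) (E := F) |>.hasFDerivAt (a x, b x))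
    (ha.prodMk_space hb)
  rw [hab] at h
  rw [add_comm]
  exact DFunLike.congr_fun h X

lemma contMDiff_curveVelocity [IsManifold I 1 M] {γ : ℝ → M} (hγ : CMDiff ∞ γ) :
    CMDiff ∞ (fun t ↦ (⟨γ t, curveVelocity I γ t⟩ : TangentBundle I M)) := by
  have h : CMDiff ∞ (fun t ↦ (⟨t, 1⟩ : TangentBundle 𝓘(ℝ, ℝ) ℝ)) := fun t ↦
    contMDiffAt_totalSpace.2 ⟨contMDiffAt_id, by
      simpa using! contMDiffAt_const (c := (1 : ℝ))⟩
  exact (hγ.contMDiff_tangentMap (by norm_cast)).comp h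

lemma curveVelocity_of_isMIntegralCurve {γ : ℝ → M} {v : ∀ x : M, TangentSpace I x}
    (hγ : IsMIntegralCurve γ v) (t : ℝ) : curveVelocity I γ t = v (γ t) := by
  rw [curveVelocity, (hγ t).mfderiv]
  exact one_smul ℝ (v (γ t))

end Calculus

namespace AffineHypersurface

variable {n : ℕ} {M : Type*} [TopologicalSpace M] [ChartedSpace (𝔼 n) M] [IsManifold (𝓡 n) ∞ M]
  (S : AffineHypersurface n M)

/-- The differential of the immersion, read in the trivialization of the tangent bundle given by
the chart at `x₀`. -/
def pushCoord (x₀ y : M) : 𝔼 n →L[ℝ] 𝔼(n + 1) :=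
  S.push y ∘L (trivializationAt (𝔼 n) (TangentSpace (𝓡 n)) x₀).symmL ℝ y

/-- The splitting `(v, a) ↦ f_* v + a ξ`, read in the trivialization of the tangent bundle given by
the chart at `x₀`. -/
def splitCoord (x₀ y : M) : (𝔼 n × ℝ) →L[ℝ] 𝔼(n + 1) :=
  (S.pushCoord x₀ y).coprod (ContinuousLinearMap.toSpanSingleton ℝ (S.ξ y))

lemma pushCoord_apply {x₀ y : M} (hy : y ∈ (chartAt (𝔼 n) x₀).source) (w : 𝔼 n) :
    S.pushCoord x₀ y w =
      S.push y ((trivializationAt (𝔼 n) (TangentSpace (𝓡 n)) x₀).symm y w) :=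
  congrArg (S.push y) (Trivialization.symmL_apply _ hy w)

lemma pushCoord_coord {x₀ y : M} (hy : y ∈ (chartAt (𝔼 n) x₀).source)
    (v : TangentSpace (𝓡 n) y) :
    S.pushCoord x₀ y (trivializationAt (𝔼 n) (TangentSpace (𝓡 n)) x₀ ⟨y, v⟩).2 = S.push y v := by
  rw [S.pushCoord_apply hy]
  exact congrArg (S.push y) (Trivialization.symm_apply_apply_mk _ hy v)

lemma contMDiffAt_pushCoord (x₀ : M) :
    ContMDiffAt (𝓡 n) 𝓘(ℝ, 𝔼 n →L[ℝ] 𝔼(n + 1)) ∞ (S.pushCoord x₀) x₀ := by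
  refine ((S.smooth_f x₀).mfderiv_const (m := ∞) (by norm_cast)).congr_of_eventuallyEq
    (Filter.Eventually.of_forall fun y ↦ ?_)
  simp only [inTangentCoordinates, ContinuousLinearMap.inCoordinates]
  rw [TangentBundle.continuousLinearMapAt_model_space]
  rfl

lemma contMDiffAt_splitCoord (x₀ : M) :
    ContMDiffAt (𝓡 n) 𝓘(ℝ, (𝔼 n × ℝ) →L[ℝ] 𝔼(n + 1)) ∞ (S.splitCoord x₀) x₀ := by
  have hξ : ContMDiffAt (𝓡 n) 𝓘(ℝ, ℝ →L[ℝ] 𝔼(n + 1)) ∞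
      (fun y ↦ ContinuousLinearMap.toSpanSingletonCLE (𝕜 := ℝ) (S.ξ y)) x₀ :=
    ContinuousLinearMap.toSpanSingletonCLE.contDiff.contDiffAt.comp_contMDiffAt (S.smooth_ξ x₀)
  exact (ContinuousLinearMap.coprodEquivL (𝕜 := ℝ) (S := ℝ)).contDiff.contDiffAt.comp_contMDiffAt
    ((S.contMDiffAt_pushCoord x₀).prodMk_space hξ)

lemma splitCoord_coord {x₀ y : M} (hy : y ∈ (chartAt (𝔼 n) x₀).source) (w : 𝔼(n + 1)) :
    S.splitCoord x₀ y ((trivializationAt (𝔼 n) (TangentSpace (𝓡 n)) x₀ ⟨y, S.tangentPart y w⟩).2,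
      S.transversalPart y w) = w := by
  rw [splitCoord, ContinuousLinearMap.coprod_apply, S.pushCoord_coord hy]
  exact S.split_eq y w

lemma isInvertible_splitCoord {x₀ y : M} (hy : y ∈ (chartAt (𝔼 n) x₀).source) :
    (S.splitCoord x₀ y).IsInvertible := by
  have hsurj : Function.Surjective (S.splitCoord x₀ y).toLinearMap :=
    fun w ↦ ⟨_, S.splitCoord_coord hy w⟩
  have hinj := (LinearMap.injective_iff_surjective_of_finrank_eq_finrank (by simp)).2 hsurj
  exact ⟨(LinearEquiv.ofBijective _ ⟨hinj, hsurj⟩).toContinuousLinearEquiv, rfl⟩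

lemma inverse_splitCoord_apply {x₀ y : M} (hy : y ∈ (chartAt (𝔼 n) x₀).source) (w : 𝔼(n + 1)) :
    (S.splitCoord x₀ y).inverse w =
      ((trivializationAt (𝔼 n) (TangentSpace (𝓡 n)) x₀ ⟨y, S.tangentPart y w⟩).2,
        S.transversalPart y w) := by
  conv_lhs => rw [← S.splitCoord_coord hy w]
  exact (S.isInvertible_splitCoord hy).inverse_apply_eq.2 rfl

lemma contMDiffAt_inverse_splitCoord (x₀ : M) :
    ContMDiffAt (𝓡 n) 𝓘(ℝ, 𝔼(n + 1) →L[ℝ] (𝔼 n × ℝ)) ∞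
      (fun y ↦ (S.splitCoord x₀ y).inverse) x₀ :=
  ((S.isInvertible_splitCoord (mem_chart_source (𝔼 n) x₀)).contDiffAt_map_inverse).comp_contMDiffAt
    (S.contMDiffAt_splitCoord x₀)

lemma contMDiff_transversalPart :
    ContMDiff (𝓡 n) 𝓘(ℝ, 𝔼(n + 1) →L[ℝ] ℝ) ∞ S.transversalPart := by
  intro x₀
  have h : ContMDiffAt (𝓡 n) 𝓘(ℝ, 𝔼(n + 1) →L[ℝ] ℝ) ∞ (fun y ↦ ContinuousLinearMap.snd ℝ (𝔼 n) ℝ ∘L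
      (S.splitCoord x₀ y).inverse) x₀ :=
    contMDiffAt_const.clm_comp (S.contMDiffAt_inverse_splitCoord x₀)
  refine h.congr_of_eventuallyEq ?_
  filter_upwards [chart_source_mem_nhds (𝔼 n) x₀] with y hy
  ext1 w
  exact (congrArg Prod.snd (S.inverse_splitCoord_apply hy w)).symm

lemma contMDiff_tangentPart {w : M → 𝔼(n + 1)} (hw : ContMDiff (𝓡 n) 𝓘(ℝ, 𝔼(n + 1)) ∞ w) :
    ContMDiff (𝓡 n) (𝓡 n).tangent ∞ (T% (fun y ↦ S.tangentPart y (w y))) := by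
  intro x₀
  have h : ContMDiffAt (𝓡 n) 𝓘(ℝ, 𝔼 n) ∞ (fun y ↦ ((S.splitCoord x₀ y).inverse (w y)).1) x₀ :=
    contDiff_fst.contDiffAt.comp_contMDiffAt
      ((S.contMDiffAt_inverse_splitCoord x₀).clm_apply (hw x₀))
  refine contMDiffAt_totalSpace.2 ⟨contMDiffAt_id, h.congr_of_eventuallyEq ?_⟩
  filter_upwards [chart_source_mem_nhds (𝔼 n) x₀] with y hy
  rw [S.inverse_splitCoord_apply hy]

lemma mvfderiv_pushField_extend {x : M} (v X : TangentSpace (𝓡 n) x) :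
    mvfderiv (𝓡 n) (S.pushField (FiberBundle.extend (𝔼 n) v)) x X =
      mvfderiv (𝓡 n) (S.pushCoord x) x X
        (trivializationAt (𝔼 n) (TangentSpace (𝓡 n)) x ⟨x, v⟩).2 := by
  set w := (trivializationAt (𝔼 n) (TangentSpace (𝓡 n)) x ⟨x, v⟩).2
  have heq : S.pushField (FiberBundle.extend (𝔼 n) v) =ᶠ[nhds x] fun y ↦ S.pushCoord x y w := by
    filter_upwards [chart_source_mem_nhds (𝔼 n) x] with y hy
    exact (S.pushCoord_apply hy w).symm
  have hderiv := mvfderiv_comp_of_hasFDerivAt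
    (ContinuousLinearMap.apply ℝ (𝔼(n + 1)) w).hasFDerivAt
    ((S.contMDiffAt_pushCoord x).mdifferentiableAt (by simp))
  exact DFunLike.congr_fun (heq.mfderiv_eq.trans hderiv) X

lemma covDerivAlong_inducedConnection {γ : ℝ → M} {V : ∀ t, TangentSpace (𝓡 n) (γ t)} {t : ℝ}
    (hγ : MDifferentiableAt 𝓘(ℝ, ℝ) (𝓡 n) γ t)
    (hV : DifferentiableAt ℝ
      (fun s ↦ (trivializationAt (𝔼 n) (TangentSpace (𝓡 n)) (γ t) ⟨γ s, V s⟩).2) t) :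
    covDerivAlong S.inducedConnection γ V t =
      S.tangentPart (γ t) (deriv (fun s ↦ S.push (γ s) (V s)) t) := by
  have hpush : (fun s ↦ S.push (γ s) (V s)) =ᶠ[nhds t] fun s ↦ S.pushCoord (γ t) (γ s)
      (trivializationAt (𝔼 n) (TangentSpace (𝓡 n)) (γ t) ⟨γ s, V s⟩).2 := by
    filter_upwards [hγ.continuousAt.preimage_mem_nhds (chart_source_mem_nhds (𝔼 n) (γ t))]
      with s hs
    exact (S.pushCoord_coord hs (V s)).symm
  have hderiv := (hasDerivAt_comp_curve
    ((S.contMDiffAt_pushCoord (γ t)).mdifferentiableAt (by simp)) hγ).clm_apply hV.hasDerivAt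
  rw [hpush.deriv_eq, hderiv.deriv, map_add, add_comm, ← mvfderiv_pushField_extend,
    S.pushCoord_apply (mem_chart_source _ _), tangentPart_push]
  rfl

theorem isGeodesic_inducedConnection_iff {γ : ℝ → M} :
    IsGeodesic S.inducedConnection γ ↔
      ContMDiff 𝓘(ℝ, ℝ) (𝓡 n) ∞ γ ∧ ∀ t, S.tangentPart (γ t) (deriv (deriv (S.f ∘ γ)) t) = 0 := by
  refine and_congr_right fun hγ ↦ forall_congr' fun t ↦ ?_
  have hγd : MDifferentiable 𝓘(ℝ, ℝ) (𝓡 n) γ := hγ.mdifferentiable (by simp)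
  have hV : DifferentiableAt ℝ (fun s ↦ (trivializationAt (𝔼 n) (TangentSpace (𝓡 n)) (γ t)
      ⟨γ s, curveVelocity (𝓡 n) γ s⟩).2) t :=
    (contMDiffAt_totalSpace.1 (contMDiff_curveVelocity hγ t)).2.contDiffAt.differentiableAt
      (by simp)
  have hderiv : deriv (S.f ∘ γ) = fun s ↦ S.push (γ s) (curveVelocity (𝓡 n) γ s) :=
    funext fun s ↦
      (hasDerivAt_comp_curve (S.smooth_f.mdifferentiable (by simp) (γ s)) (hγd s)).deriv
  rw [S.covDerivAlong_inducedConnection (hγd t) hV, hderiv]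

end AffineHypersurface

section CentralAcceleration

variable {F : Type*} [NormedAddCommGroup F]

lemma eq_zero_of_hasDerivAt_smul_self [NormedSpace ℝ F] {y : ℝ → F} {l : ℝ → ℝ} (hl : Continuous l)
    (hy : ∀ t, HasDerivAt y (l t • y t) t) (h0 : y 0 = 0) (t : ℝ) : y t = 0 := by
  have hL (t : ℝ) : HasDerivAt (fun t ↦ ∫ s in (0 : ℝ)..t, l s) (l t) t :=
    intervalIntegral.integral_hasDerivAt_right (hl.intervalIntegrable _ _)
      (hl.stronglyMeasurableAtFilter _ _) hl.continuousAt
  have hz (t : ℝ) : HasDerivAt (fun t ↦ Real.exp (-∫ s in (0 : ℝ)..t, l s) • y t) 0 t := by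
    refine ((hL t).neg.exp.smul (hy t)).congr_deriv ?_
    module
  have hconst := is_const_of_deriv_eq_zero (fun t ↦ (hz t).differentiableAt)
    (fun t ↦ (hz t).deriv) t 0
  simpa [h0, Real.exp_ne_zero] using hconst

lemma apply_apply_eq_neg_smul_of_hasDerivAt [NormedSpace ℝ F] {J : F →L[ℝ] F} {D : ℝ}
    (hJ : ∀ z, J (J (J z)) = -D • J z) {σ : ℝ → F} {k l : ℝ → ℝ} (hl : Continuous l)
    (hσ : ∀ t, HasDerivAt σ (k t • J (σ t) + l t • σ t) t) (h0 : J (J (σ 0)) = -D • σ 0) (t : ℝ) :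
    J (J (σ t)) = -D • σ t := by
  suffices h : J (J (σ t)) + D • σ t = 0 by rw [eq_neg_of_add_eq_zero_left h, neg_smul]
  refine eq_zero_of_hasDerivAt_smul_self (y := fun t ↦ J (J (σ t)) + D • σ t) hl
    (fun t ↦ ?_) (by simp [h0]) t
  have h := (J.hasFDerivAt.comp_hasDerivAt t (J.hasFDerivAt.comp_hasDerivAt t (hσ t))).add
    ((hσ t).const_smul D)
  refine h.congr_deriv ?_
  simp only [map_add, map_smul, hJ]
  module

variable [InnerProductSpace ℝ F]

/-- The vector field `z ↦ ‖z‖⁻² J z`. For `J` skew-symmetric it turns the plane of `J` around the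
origin with constant areal velocity. -/
def arealRotation (J : F →L[ℝ] F) (z : F) : F := (‖z‖ ^ 2)⁻¹ • J z

lemma contDiffAt_arealRotation (J : F →L[ℝ] F) {z : F} (hz : z ≠ 0) :
    ContDiffAt ℝ ∞ (arealRotation J) z :=
  ((contDiff_norm_sq ℝ).contDiffAt.inv (pow_ne_zero _ (norm_ne_zero_iff.2 hz))).smul
    J.contDiff.contDiffAt

theorem exists_hasDerivAt_deriv_eq_smul_of_arealRotation {J : F →L[ℝ] F} {D : ℝ}
    (hskew : ∀ z, inner ℝ z (J z) = 0) (hJ : ∀ z, J (J (J z)) = -D • J z) {σ : ℝ → F} {l : ℝ → ℝ}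
    (hl : Differentiable ℝ l) (hne : ∀ t, σ t ≠ 0)
    (hσ : ∀ t, HasDerivAt σ (arealRotation J (σ t) + l t • σ t) t)
    (h0 : J (J (σ 0)) = -D • σ 0) (t : ℝ) :
    ∃ μ : ℝ, HasDerivAt (deriv σ) (μ • σ t) t := by
  have hplane : J (J (σ t)) = -D • σ t :=
    apply_apply_eq_neg_smul_of_hasDerivAt hJ hl.continuous hσ h0 t
  have hderiv : deriv σ = fun t ↦ (‖σ t‖ ^ 2)⁻¹ • J (σ t) + l t • σ t :=
    funext fun t ↦ (hσ t).deriv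
  have hnorm : ‖σ t‖ ^ 2 ≠ 0 := pow_ne_zero _ (norm_ne_zero_iff.2 (hne t))
  have h := (((hσ t).norm_sq.inv hnorm).smul (J.hasFDerivAt.comp_hasDerivAt t (hσ t))).add
    ((hl t).hasDerivAt.smul (hσ t))
  rw [hderiv]
  -- The two `J (σ t)` terms coming from `l` cancel against the derivative of `‖σ‖⁻²`.
  refine ⟨-D * ((‖σ t‖ ^ 2)⁻¹) ^ 2 + deriv l t + l t ^ 2, h.congr_deriv ?_⟩
  simp only [arealRotation, inner_add_right, inner_smul_right, hskew, map_add, map_smul, hplane,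
    real_inner_self_eq_norm_sq, Function.comp_apply, Pi.inv_apply]
  match_scalars <;> field_simp <;> ring

open InnerProductSpace in
/-- The skew-symmetric operator `p ∧ w`, that is, `z ↦ ⟨p, z⟩ w - ⟨w, z⟩ p`. -/
def skewOperator (p w : F) : F →L[ℝ] F := rankOne ℝ w p - rankOne ℝ p w

lemma skewOperator_apply (p w z : F) :
    skewOperator p w z = inner ℝ p z • w - inner ℝ w z • p := rfl

lemma inner_skewOperator_self (p w z : F) : inner ℝ z (skewOperator p w z) = 0 := by
  rw [skewOperator_apply, inner_sub_right, inner_smul_right, inner_smul_right,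
    real_inner_comm p, real_inner_comm w]
  ring

lemma skewOperator_skewOperator_left (p w : F) :
    skewOperator p w (skewOperator p w p) =
      -(inner ℝ p p * inner ℝ w w - inner ℝ p w ^ 2) • p := by
  simp only [skewOperator_apply, inner_sub_right, inner_smul_right, real_inner_comm p w]
  module

lemma skewOperator_cube_apply (p w z : F) :
    skewOperator p w (skewOperator p w (skewOperator p w z)) =
      -(inner ℝ p p * inner ℝ w w - inner ℝ p w ^ 2) • skewOperator p w z := by
  simp only [skewOperator_apply, inner_sub_right, inner_smul_right, real_inner_comm p w]
  module

end CentralAcceleration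

namespace AffineHypersurface

section TransversalField

variable {n : ℕ} {M : Type*} [TopologicalSpace M] [ChartedSpace (𝔼 n) M]
  (S : AffineHypersurface n M)

lemma split_symm_ξ (x : M) : (S.split x).symm (S.ξ x) = (0, 1) := by
  rw [LinearEquiv.symm_apply_eq]
  exact (by simp [splitMap_apply] : S.ξ x = S.splitMap x (0, 1))

lemma tangentPart_ξ (x : M) : S.tangentPart x (S.ξ x) = 0 :=
  congrArg Prod.fst (S.split_symm_ξ x)

lemma transversalPart_ξ (x : M) : S.transversalPart x (S.ξ x) = 1 :=
  congrArg Prod.snd (S.split_symm_ξ x)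

lemma ξ_ne_zero (x : M) : S.ξ x ≠ 0 := fun h ↦ S.transversal x ⟨0, by simp [h]⟩

variable {S} {c : 𝔼(n + 1)} {a : ℝ} (hξ : ∀ y, S.ξ y = a • (S.f y - c))
include hξ

lemma sub_center_ne_zero (y : M) : S.f y - c ≠ 0 :=
  (smul_ne_zero_iff.1 (hξ y ▸ S.ξ_ne_zero y)).2

lemma tangentPart_sub_center (y : M) : S.tangentPart y (S.f y - c) = 0 := by
  have h := S.tangentPart_ξ y
  rw [hξ, map_smul] at h
  exact (smul_eq_zero.1 h).resolve_left (smul_ne_zero_iff.1 (hξ y ▸ S.ξ_ne_zero y)).1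

end TransversalField

section Completeness

variable {n : ℕ} {M : Type*} [TopologicalSpace M] [ChartedSpace (𝔼 n) M]
  (S : AffineHypersurface n M)

/-- The vector field on `M` given by the tangential component, along the transversal field, of the
rotation `arealRotation J` about the point `c`. -/
def rotationField (c : 𝔼(n + 1)) (J : 𝔼(n + 1) →L[ℝ] 𝔼(n + 1)) (y : M) :
    TangentSpace (𝓡 n) y :=
  S.tangentPart y (arealRotation J (S.f y - c))

variable {S} {c : 𝔼(n + 1)} {a : ℝ}

lemma contMDiff_arealRotation_sub (hc : ∀ y, S.f y - c ≠ 0) (J : 𝔼(n + 1) →L[ℝ] 𝔼(n + 1)) :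
    ContMDiff (𝓡 n) 𝓘(ℝ, 𝔼(n + 1)) ∞ (fun y ↦ arealRotation J (S.f y - c)) := fun y ↦
  (contDiffAt_arealRotation J (hc y)).comp_contMDiffAt (f := fun y ↦ S.f y - c)
    ((S.smooth_f.sub contMDiff_const) y)

lemma rotationField_skewOperator_self (hξ : ∀ y, S.ξ y = a • (S.f y - c)) (x : M)
    (v : TangentSpace (𝓡 n) x) :
    S.rotationField c (skewOperator (S.f x - c) (S.push x v)) x = v := by
  have hnorm : ‖S.f x - c‖ ^ 2 ≠ 0 :=
    pow_ne_zero _ (norm_ne_zero_iff.2 (sub_center_ne_zero hξ x))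
  rw [rotationField, arealRotation, skewOperator_apply, map_smul, map_sub, map_smul, map_smul,
    tangentPart_sub_center hξ, tangentPart_push, real_inner_self_eq_norm_sq, smul_zero, sub_zero,
    inv_smul_smul₀ hnorm]

lemma push_rotationField (hξ : ∀ y, S.ξ y = a • (S.f y - c)) (J : 𝔼(n + 1) →L[ℝ] 𝔼(n + 1))
    (y : M) :
    S.push y (S.rotationField c J y) = arealRotation J (S.f y - c) +
      -(S.transversalPart y (arealRotation J (S.f y - c)) * a) • (S.f y - c) := by
  have h := S.split_eq y (arealRotation J (S.f y - c))
  rw [hξ, smul_smul] at h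
  rw [neg_smul, ← sub_eq_add_neg]
  exact eq_sub_of_add_eq h

variable [IsManifold (𝓡 n) ∞ M]

lemma contMDiff_rotationField (hc : ∀ y, S.f y - c ≠ 0) (J : 𝔼(n + 1) →L[ℝ] 𝔼(n + 1)) :
    ContMDiff (𝓡 n) (𝓡 n).tangent ∞ (T% (S.rotationField c J)) :=
  S.contMDiff_tangentPart (contMDiff_arealRotation_sub hc J)

theorem isGeodesic_of_isMIntegralCurve_rotationField (hξ : ∀ y, S.ξ y = a • (S.f y - c))
    {J : 𝔼(n + 1) →L[ℝ] 𝔼(n + 1)} {D : ℝ}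
    (hskew : ∀ z, inner ℝ z (J z) = 0) (hJ : ∀ z, J (J (J z)) = -D • J z) {γ : ℝ → M}
    (hγ : IsMIntegralCurve γ (S.rotationField c J))
    (h0 : J (J (S.f (γ 0) - c)) = -D • (S.f (γ 0) - c)) :
    IsGeodesic S.inducedConnection γ := by
  have hne := sub_center_ne_zero hξ
  have hγs : ContMDiff 𝓘(ℝ, ℝ) (𝓡 n) ∞ γ :=
    contMDiff_of_isMIntegralCurve hγ (contMDiff_rotationField hne J)
  refine S.isGeodesic_inducedConnection_iff.2 ⟨hγs, fun t ↦ ?_⟩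
  set l : ℝ → ℝ := fun s ↦
    -(S.transversalPart (γ s) (arealRotation J (S.f (γ s) - c)) * a)
  have hl : Differentiable ℝ l := by
    have h := (S.contMDiff_transversalPart.clm_apply (contMDiff_arealRotation_sub hne J)).comp hγs
    exact ((h.contDiff.differentiable (by simp)).mul_const a).neg
  have hσ (s : ℝ) : HasDerivAt (fun s ↦ S.f (γ s) - c)
      (arealRotation J (S.f (γ s) - c) + l s • (S.f (γ s) - c)) s := by
    rw [← push_rotationField hξ, ← curveVelocity_of_isMIntegralCurve hγ]
    exact (hasDerivAt_comp_curve (S.smooth_f.mdifferentiable (by simp) (γ s))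
      (hγs.mdifferentiable (by simp) s)).sub_const c
  obtain ⟨μ, hμ⟩ := exists_hasDerivAt_deriv_eq_smul_of_arealRotation hskew hJ hl
    (fun s ↦ hne (γ s)) hσ h0 t
  have hderiv : deriv (S.f ∘ γ) = deriv (fun s ↦ S.f (γ s) - c) :=
    funext fun s ↦ (deriv_sub_const c).symm
  rw [hderiv, hμ.deriv, map_smul, tangentPart_sub_center hξ, smul_zero]

theorem isGeodesicallyComplete_inducedConnection [CompactSpace M] [T2Space M]
    (hS : S.IsCentroaffine) : IsGeodesicallyComplete S.inducedConnection := by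
  obtain ⟨c, a, -, hξ⟩ := hS
  intro x v
  set J := skewOperator (S.f x - c) (S.push x v)
  have hsmooth := contMDiff_rotationField (sub_center_ne_zero hξ) J
  obtain ⟨γ, hγ0, hγ⟩ := exists_isMIntegralCurve_of_compactSpace (hsmooth.of_le (by norm_cast)) x
  refine ⟨γ, isGeodesic_of_isMIntegralCurve_rotationField hξ (inner_skewOperator_self _ _)
    (skewOperator_cube_apply _ _) hγ (by rw [hγ0]; exact skewOperator_skewOperator_left _ _), ?_⟩
  calc (⟨γ 0, curveVelocity (𝓡 n) γ 0⟩ : TangentBundle (𝓡 n) M)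
    _ = ⟨γ 0, S.rotationField c J (γ 0)⟩ := by rw [curveVelocity_of_isMIntegralCurve hγ]
    _ = ⟨x, S.rotationField c J x⟩ := by rw [hγ0]
    _ = ⟨x, v⟩ := by rw [rotationField_skewOperator_self hξ]

end Completeness

end AffineHypersurface

section DualConnection

variable {E : Type*} [NormedAddCommGroup E] [NormedSpace ℝ E]
  {H : Type*} [TopologicalSpace H] {I : ModelWithCorners ℝ E H}
  {M : Type*} [TopologicalSpace M] [ChartedSpace H M] [IsManifold I 1 M]

lemma IsGeodesicallyComplete.congr
    {cov cov' : CovariantDerivative I E (TangentSpace I : M → Type _)}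
    (h : ∀ (Z : ∀ y : M, TangentSpace I y) (x : M), MDiffAt (T% Z) x → cov Z x = cov' Z x)
    (hcov : IsGeodesicallyComplete cov) : IsGeodesicallyComplete cov' := by
  intro x v
  obtain ⟨γ, ⟨hγ, hgeod⟩, h0⟩ := hcov x v
  refine ⟨γ, ⟨hγ, fun t ↦ ?_⟩, h0⟩
  rw [← hgeod t]
  simp only [covDerivAlong]
  rw [h _ _ (FiberBundle.mdifferentiableAt_extend I E _)]

theorem IsDualConnection.unique
    {g : ∀ x : M, TangentSpace I x →L[ℝ] TangentSpace I x →L[ℝ] ℝ}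
    (hg : ∀ (x : M) (w : TangentSpace I x), (∀ v, g x v w = 0) → w = 0)
    {cov cov₁ cov₂ : CovariantDerivative I E (TangentSpace I : M → Type _)}
    (h₁ : IsDualConnection g cov cov₁) (h₂ : IsDualConnection g cov cov₂)
    (Z : ∀ y : M, TangentSpace I y) (x : M) (hZ : MDiffAt (T% Z) x) :
    cov₁ Z x = cov₂ Z x := by
  ext1 X
  refine sub_eq_zero.1 (hg x _ fun v ↦ ?_)
  have hv : MDiffAt (T% (FiberBundle.extend E v)) x := FiberBundle.mdifferentiableAt_extend I E v
  have h := (h₁ x X _ Z hv hZ).symm.trans (h₂ x X _ Z hv hZ)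
  rw [FiberBundle.extend_apply_self] at h
  rw [map_sub, sub_eq_zero]
  exact add_left_cancel h

end DualConnection

namespace AffineHypersurface

section Conormal

variable {n : ℕ} {M : Type*} [TopologicalSpace M] [ChartedSpace (𝔼 n) M]
  (S : AffineHypersurface n M)

/-- The conormal vector `ν`, characterized by `⟨ν, f_* v⟩ = 0` and `⟨ν, ξ⟩ = 1`. -/
def conormal (x : M) : 𝔼(n + 1) := (InnerProductSpace.toDual ℝ _).symm (S.transversalPart x)

lemma inner_conormal (x : M) (w : 𝔼(n + 1)) :
    inner ℝ (S.conormal x) w = S.transversalPart x w :=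
  InnerProductSpace.toDual_symm_apply

variable [IsManifold (𝓡 n) ∞ M]

lemma contMDiff_conormal : ContMDiff (𝓡 n) 𝓘(ℝ, 𝔼(n + 1)) ∞ S.conormal :=
  (InnerProductSpace.toDual ℝ (𝔼(n + 1))).symm.contDiff.comp_contMDiff S.contMDiff_transversalPart

lemma mdifferentiableAt_conormal (x : M) :
    MDifferentiableAt (𝓡 n) 𝓘(ℝ, 𝔼(n + 1)) S.conormal x :=
  S.contMDiff_conormal.mdifferentiable (by simp) x

lemma inner_mvfderiv_conormal_push (x : M) (X Y : TangentSpace (𝓡 n) x) :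
    inner ℝ (mvfderiv (𝓡 n) S.conormal x X) (S.push x Y) = -S.secondFundamentalForm x Y X := by
  set Z : ∀ y : M, TangentSpace (𝓡 n) y := FiberBundle.extend (𝔼 n) Y
  have hZ : MDifferentiableAt (𝓡 n) (𝓡 n).tangent (T% Z) x :=
    FiberBundle.mdifferentiableAt_extend _ _ _
  have hZx : Z x = Y := FiberBundle.extend_apply_self _ Y
  have hzero : (fun y ↦ inner ℝ (S.conormal y) (S.pushField Z y)) = fun _ ↦ (0 : ℝ) := by
    ext1 y
    rw [inner_conormal, pushField, transversalPart_push]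
  have hgauss : mvfderiv (𝓡 n) (S.pushField Z) x X =
      S.push x (S.inducedConnection Z x X) + S.secondFundamentalForm x (Z x) X • S.ξ x :=
    S.gauss_formula X hZ
  have h := mvfderiv_inner (S.mdifferentiableAt_conormal x) (S.mdiffAt_pushField hZ) X
  rw [hzero, mvfderiv_const, hgauss, inner_conormal, map_add, map_smul, transversalPart_push,
    transversalPart_ξ, pushField, hZx, zero_apply, zero_add, smul_eq_mul, mul_one] at h
  exact eq_neg_of_add_eq_zero_left h.symm

lemma inner_mvfderiv_conormal_ξ (hS : S.IsCentroaffine) (x : M) (X : TangentSpace (𝓡 n) x) :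
    inner ℝ (mvfderiv (𝓡 n) S.conormal x X) (S.ξ x) = 0 := by
  obtain ⟨c, a, -, hξ⟩ := hS
  have hDξ : mvfderiv (𝓡 n) S.ξ x X = a • S.push x X := by
    rw [funext hξ]
    exact DFunLike.congr_fun (mvfderiv_comp_of_hasFDerivAt
      (((hasFDerivAt_id (𝕜 := ℝ) (S.f x)).sub_const c).const_smul a)
      (S.smooth_f.mdifferentiable (by simp) x)) X
  have hone : (fun y ↦ inner ℝ (S.conormal y) (S.ξ y)) = fun _ ↦ (1 : ℝ) := by
    ext1 y
    rw [inner_conormal, transversalPart_ξ]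
  have h := mvfderiv_inner (S.mdifferentiableAt_conormal x)
    (S.smooth_ξ.mdifferentiable (by simp) x) X
  rw [hone, mvfderiv_const, hDξ, inner_conormal, map_smul, transversalPart_push, smul_zero,
    add_zero] at h
  exact h.symm

end Conormal

section Dual

variable {n : ℕ} {M : Type*} [TopologicalSpace M] [ChartedSpace (𝔼 n) M] [IsManifold (𝓡 n) ∞ M]
  {S : AffineHypersurface n M}

lemma IsNondegenerate.eq_zero_of_right (hn : S.IsNondegenerate) (x : M) (w : TangentSpace (𝓡 n) x)
    (hw : ∀ v, S.secondFundamentalForm x v w = 0) : w = 0 := by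
  have : FiniteDimensional ℝ (TangentSpace (𝓡 n) x) :=
    inferInstanceAs (FiniteDimensional ℝ (𝔼 n))
  let B : LinearMap.BilinForm ℝ (TangentSpace (𝓡 n) x) :=
    ContinuousLinearMap.coeLM ℝ ∘ₗ (S.secondFundamentalForm x).toLinearMap
  have hB : B.SeparatingLeft := hn x
  exact (LinearMap.BilinForm.Nondegenerate.ofSeparatingLeft hB).2 w hw

variable (S)

/-- The conormal hypersurface `ν` of a non-degenerate centroaffine hypersurface, equipped with its
position vector as the transversal field. -/
def dual (hc : S.IsCentroaffine) (hn : S.IsNondegenerate) : AffineHypersurface n M where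
  f := S.conormal
  ξ := S.conormal
  smooth_f := S.contMDiff_conormal
  smooth_ξ := S.contMDiff_conormal
  immersion x := by
    refine (injective_iff_map_eq_zero _).2 fun X hX ↦ hn.eq_zero_of_right x X fun v ↦ ?_
    rw [← neg_eq_zero, ← inner_mvfderiv_conormal_push, hX, inner_zero_left]
  transversal x := by
    rintro ⟨X, hX⟩
    have h := S.inner_mvfderiv_conormal_ξ hc x X
    rw [hX, inner_conormal, transversalPart_ξ] at h
    exact one_ne_zero h

lemma isCentroaffine_dual (hc : S.IsCentroaffine) (hn : S.IsNondegenerate) :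
    (S.dual hc hn).IsCentroaffine :=
  ⟨0, 1, one_ne_zero, fun x ↦ by simp [dual]⟩

theorem isDualConnection_dual (hc : S.IsCentroaffine) (hn : S.IsNondegenerate) :
    IsDualConnection S.secondFundamentalForm S.inducedConnection
      (S.dual hc hn).inducedConnection := by
  intro x X Y Z hY hZ
  have hform : (fun y ↦ S.secondFundamentalForm y (Y y) (Z y)) =
      -fun y ↦ inner ℝ ((S.dual hc hn).pushField Z y) (S.pushField Y y) :=
    funext fun y ↦ neg_eq_iff_eq_neg.1 (S.inner_mvfderiv_conormal_push y (Z y) (Y y)).symm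
  have hgaussY : mvfderiv (𝓡 n) (S.pushField Y) x X =
      S.push x (S.inducedConnection Y x X) + S.secondFundamentalForm x (Y x) X • S.ξ x :=
    S.gauss_formula X hY
  have hgaussZ : mvfderiv (𝓡 n) ((S.dual hc hn).pushField Z) x X =
      mvfderiv (𝓡 n) S.conormal x ((S.dual hc hn).inducedConnection Z x X) +
        (S.dual hc hn).secondFundamentalForm x (Z x) X • S.conormal x :=
    (S.dual hc hn).gauss_formula X hZ
  have hpushZ : (S.dual hc hn).pushField Z x = mvfderiv (𝓡 n) S.conormal x (Z x) := rfl
  rw [hform, mvfderiv_neg, neg_apply,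
    mvfderiv_inner ((S.dual hc hn).mdiffAt_pushField hZ) (S.mdiffAt_pushField hY), hgaussY, hgaussZ,
    hpushZ, inner_add_left, inner_add_right, inner_smul_left, inner_smul_right, pushField,
    inner_mvfderiv_conormal_push, inner_mvfderiv_conormal_push, inner_mvfderiv_conormal_ξ S hc,
    inner_conormal, transversalPart_push]
  ring

end Dual

end AffineHypersurface

end

theorem theorem5p4_general {n : ℕ} {M : Type*} [TopologicalSpace M]
    [ChartedSpace (EuclideanSpace ℝ (Fin n)) M] [IsManifold (𝓡 n) ∞ M] [CompactSpace M] [T2Space M]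
    (S : AffineHypersurface n M) (hc : S.IsCentroaffine) (hn : S.IsNondegenerate) :
    IsGeodesicallyComplete S.inducedConnection ∧
      (∃ dualConn, IsDualConnection S.secondFundamentalForm S.inducedConnection dualConn) ∧
      ∀ dualConn, IsDualConnection S.secondFundamentalForm S.inducedConnection dualConn →
        IsGeodesicallyComplete dualConn := by
  have hdual := S.isDualConnection_dual hc hn
  refine ⟨AffineHypersurface.isGeodesicallyComplete_inducedConnection hc, ⟨_, hdual⟩,
    fun dualConn h ↦ ?_⟩
  exact IsGeodesicallyComplete.congr (hdual.unique hn.eq_zero_of_right h)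
    (AffineHypersurface.isGeodesicallyComplete_inducedConnection (S.isCentroaffine_dual hc hn))

theorem theorem5p4 {n : ℕ} {M : Type*} [TopologicalSpace M]
    [ChartedSpace (EuclideanSpace ℝ (Fin n)) M] [IsManifold (𝓡 n) ∞ M]
    (S : AffineHypersurface n M) (hS : S.IsCentroaffineOvaloid) :
    IsGeodesicallyComplete S.inducedConnection ∧
      (∃ dualConn, IsDualConnection S.secondFundamentalForm S.inducedConnection dualConn) ∧
      ∀ dualConn, IsDualConnection S.secondFundamentalForm S.inducedConnection dualConn →
        IsGeodesicallyComplete dualConn := by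
  obtain ⟨⟨φ⟩, hc, hn⟩ := hS
  have : CompactSpace M := φ.toHomeomorph.symm.compactSpace
  have : T2Space M := φ.toHomeomorph.symm.t2Space
  exact theorem5p4_general S hc hn
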